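/- **Definitions.** All graphs are simple, finite and undirected. In a graph $G$ whose vertices and edges are all colored (adjacent or incident elements may receive the same color), a path is a *total proper path* if any two consecutive edges of the path differ in color, any two consecutive internal vertices of the path differ in color, and every internal vertex of the path differs in color from the two edges of the path incident with it. The *total proper connection number* $tpc(G)$ of a connected graph $G$ is the smallest number of colors in a coloring of the vertices and edges of $G$ such that any two vertices of $G$ are connected by a total proper path. **Proposition 3.** Let $k\ge 2$. Let $G$ be the graph obtained from an even cycle of length $4\cdot 2^{k}$, divided by four vertices $u_1,u_2,u_3,u_4$ (in cyclic order) into four segments of $2^{k}$ edges each, by adding two ears of length $2^{k}$: a path joining $u_1$ and $u_2$ and a path joining $u_3$ and $u_4$, whose internal vertices are new and distinct. Then $G$ is 2-connected and bipartite, and $tpc(G)=4$. (Hence the upper bound $4$ for the total proper connection number of 2-connected graphs, proved in the same paper, is sharp, even among bipartite graphs.) -/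

import Mathlib

namespace TotalProper

variable {V : Type*}

/-- A path `p` (a walk that repeats no vertex) is a total proper path for the colors `cv` of the
vertices and `ce` of the edges if consecutive edges of the path differ in color, consecutive
internal vertices of the path differ in color, and every internal vertex of the path differs in
color from the two edges of the path that are incident with it. The internal vertices of `p` are
the `p.getVert i` with `0 < i < p.length`. -/
structure IsTotalProperPath {α : Type*} (G : SimpleGraph V) (cv : V → α) (ce : Sym2 V → α)
    {u v : V} (p : G.Walk u v) : Prop where
  isPath : p.IsPath
  edge_ne_edge : ∀ i, i + 2 ≤ p.length →
    ce s(p.getVert i, p.getVert (i + 1)) ≠ ce s(p.getVert (i + 1), p.getVert (i + 2))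
  vert_ne_vert : ∀ i, 0 < i → i + 1 < p.length →
    cv (p.getVert i) ≠ cv (p.getVert (i + 1))
  vert_ne_edge : ∀ i, i + 2 ≤ p.length →
    cv (p.getVert (i + 1)) ≠ ce s(p.getVert i, p.getVert (i + 1)) ∧
    cv (p.getVert (i + 1)) ≠ ce s(p.getVert (i + 1), p.getVert (i + 2))

/-- The total-coloring `(cv, ce)` makes `G` total proper connected: any two vertices are joined by
a total proper path. (Only the values of `ce` at edges of `G` matter.) -/
def IsTotalProperConnected {α : Type*} (G : SimpleGraph V) (cv : V → α) (ce : Sym2 V → α) : Prop :=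
  ∀ u v : V, ∃ p : G.Walk u v, IsTotalProperPath G cv ce p

/-- The total proper connection number: the least `n` such that some total-coloring of `G` with
colors from one set of `n` colors makes `G` total proper connected. -/
noncomputable def tpc (G : SimpleGraph V) : ℕ :=
  sInf {n : ℕ | ∃ (cv : V → Fin n) (ce : Sym2 V → Fin n), IsTotalProperConnected G cv ce}

/-- A graph is 2-connected if it is connected, has at least three vertices, and stays connected
when any one vertex is deleted. -/
def IsTwoConnected (G : SimpleGraph V) : Prop :=
  G.Connected ∧ 3 ≤ Nat.card V ∧ ∀ v : V, (G.induce {v}ᶜ).Connected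

/-- Vertices of the cycle with two ears whose six segments have `L` edges: the four vertices
`u₀, u₁, u₂, u₃` at the ends of the segments, and `L - 1` internal vertices in each segment. The
segments are numbered so that `0, 1, 2, 3` are the segments of the cycle, in cyclic order, and `4`
and `5` are the ears that join the ends of the segments `0` and `2`, respectively. -/
abbrev EarVertex (L : ℕ) : Type := Fin 4 ⊕ (Fin 6 × Fin (L - 1))

/-- The index of the first vertex of each segment. -/
def segStart : Fin 6 → Fin 4 := ![0, 1, 2, 3, 0, 2]

/-- The index of the last vertex of each segment. -/
def segEnd : Fin 6 → Fin 4 := ![1, 2, 3, 0, 1, 3]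

/-- The `i`-th vertex of the segment `s`, for `0 ≤ i ≤ L`. -/
def segVertex (L : ℕ) (s : Fin 6) (i : ℕ) : EarVertex L :=
  if i = 0 then Sum.inl (segStart s)
  else if h : i - 1 < L - 1 then Sum.inr (s, ⟨i - 1, h⟩)
  else Sum.inl (segEnd s)

/-- The graph obtained from a cycle with `4 * L` edges, divided into four consecutive segments of
`L` edges each, by adding two ears of length `L`, one joining the ends of the first segment and the
other joining the ends of the third: two vertices are adjacent if and only if they are consecutive
in one of the six segments. -/
def cycleWithTwoEars (L : ℕ) : SimpleGraph (EarVertex L) :=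
  SimpleGraph.fromRel fun x y => ∃ (s : Fin 6) (i : ℕ),
    i < L ∧ x = segVertex L s i ∧ y = segVertex L s (i + 1)

end TotalProper

/-! Four colors suffice: edges alternate between two colors along each segment and vertices
alternate between two others. As `L` is even, the pattern continues through every junction, so any
path that follows segments in their numbered directions is total proper, and three routes of five
segments each cover all pairs of vertices (`exists_route`).

Three colors do not suffice. Read them in `ZMod 3`. Along a total proper path any three consecutive
elements (vertices and edges, endpoints excluded) have distinct colors, so the color changes by a
constant `1` or `-1`. Any two vertices thus have incident edges of which one reaches the other in
the digraph of color-increasing incidences, and the same holds for the negated coloring.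

A segment that is not monotone has a turning point, and some vertex beyond its middle is then
incident only with edges whose reachable sets stay inside the segment, for the coloring or for its
negative (`IsBroken.exists_isStuck`). Two such segments for the same sign contradict comparability
(`IsStuck.fst_eq`), so at most two segments are broken. Monotone segments form no directed cycle of
junctions, because `2 * L` is not divisible by 3 (`not_transGen_junctionStep`). Hence no junction
has two monotone segments both entering it or both leaving it (`not_down_and_down`), and each of the
four junctions, having degree three, meets a broken segment. The two broken segments then leave two
monotone ones at each junction, one of which leaves it. Following these outgoing segments closes a
directed cycle, a contradiction. -/

namespace TotalProper

/-! ### Coordinates on the six segments. -/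

section Structure

variable {L : ℕ}

theorem segVertex_zero (s : Fin 6) : segVertex L s 0 = Sum.inl (segStart s) := by
  simp [segVertex]

theorem segVertex_last (hL : 0 < L) (s : Fin 6) : segVertex L s L = Sum.inl (segEnd s) := by
  simp [segVertex, hL.ne']

theorem segVertex_interior {i : ℕ} (h0 : 0 < i) (hi : i < L) (s : Fin 6) :
    segVertex L s i = Sum.inr (s, ⟨i - 1, by omega⟩) := by
  have h : i - 1 < L - 1 := by omega
  simp [segVertex, h0.ne', h]

theorem segVertex_eq_inl (hL : 0 < L) {s : Fin 6} {i : ℕ} (hi : i ≤ L) {m : Fin 4}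
    (h : segVertex L s i = Sum.inl m) : (i = 0 ∧ segStart s = m) ∨ (i = L ∧ segEnd s = m) := by
  rcases Nat.eq_zero_or_pos i with rfl | h0
  · exact Or.inl ⟨rfl, by simpa [segVertex_zero] using h⟩
  rcases hi.eq_or_lt with rfl | hi
  · exact Or.inr ⟨rfl, by simpa [segVertex_last hL] using h⟩
  · simp [segVertex_interior h0 hi] at h

theorem segVertex_inj {s s' : Fin 6} {i i' : ℕ} (h0 : 0 < i) (hi : i < L) (hi' : i' ≤ L)
    (h : segVertex L s i = segVertex L s' i') : s = s' ∧ i = i' := by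
  rcases Nat.eq_zero_or_pos i' with rfl | h0'
  · simp [segVertex_interior h0 hi, segVertex_zero] at h
  rcases hi'.eq_or_lt with rfl | hi'
  · simp [segVertex_interior h0 hi, segVertex_last h0'] at h
  · rw [segVertex_interior h0 hi, segVertex_interior h0' hi'] at h
    simp only [Sum.inr.injEq, Prod.mk.injEq, Fin.mk.injEq] at h
    exact ⟨h.1, by omega⟩

theorem segStart_ne_segEnd (s : Fin 6) : segStart s ≠ segEnd s := by
  revert s; decide

theorem segVertex_injOn {s : Fin 6} {i i' : ℕ} (hi : i ≤ L) (hi' : i' ≤ L)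
    (h : segVertex L s i = segVertex L s i') : i = i' := by
  rcases Nat.eq_zero_or_pos L with rfl | hL
  · omega
  by_cases h1 : 0 < i ∧ i < L
  · exact (segVertex_inj h1.1 h1.2 hi' h).2
  by_cases h2 : 0 < i' ∧ i' < L
  · exact (segVertex_inj h2.1 h2.2 hi h.symm).2.symm
  have h3 : i = 0 ∨ i = L := by omega
  have h4 : i' = 0 ∨ i' = L := by omega
  have hs := segStart_ne_segEnd s
  rcases h3 with rfl | rfl <;> rcases h4 with rfl | rfl <;>
    simp_all [segVertex_zero, segVertex_last, eq_comm]

theorem exists_segVertex (hL : 0 < L) (v : EarVertex L) :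
    ∃ (s : Fin 6) (i : ℕ), i ≤ L ∧ v = segVertex L s i := by
  rcases v with m | ⟨s, i⟩
  · have : ∃ s : Fin 6, segStart s = m := by revert m; decide
    obtain ⟨s, rfl⟩ := this
    exact ⟨s, 0, by omega, (segVertex_zero s).symm⟩
  · refine ⟨s, i + 1, by omega, ?_⟩
    rw [segVertex_interior (by omega) (by omega)]
    simp

theorem adj_segVertex (s : Fin 6) {i : ℕ} (hi : i < L) :
    (cycleWithTwoEars L).Adj (segVertex L s i) (segVertex L s (i + 1)) := by
  rw [cycleWithTwoEars, SimpleGraph.fromRel_adj]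
  refine ⟨fun h => ?_, Or.inl ⟨s, i, hi, rfl, rfl⟩⟩
  have := segVertex_injOn hi.le hi h
  omega

theorem exists_of_adj {x y : EarVertex L} (h : (cycleWithTwoEars L).Adj x y) :
    ∃ (s : Fin 6) (i : ℕ), i < L ∧ ((x = segVertex L s i ∧ y = segVertex L s (i + 1)) ∨
      (y = segVertex L s i ∧ x = segVertex L s (i + 1))) := by
  rw [cycleWithTwoEars, SimpleGraph.fromRel_adj] at h
  rcases h.2 with ⟨s, i, hi, h1, h2⟩ | ⟨s, i, hi, h1, h2⟩
  · exact ⟨s, i, hi, Or.inl ⟨h1, h2⟩⟩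
  · exact ⟨s, i, hi, Or.inr ⟨h1, h2⟩⟩

/-- The edge between the vertices `i` and `i + 1` of a segment determines the segment and `i`. -/
theorem segEdge_inj (hL : 3 ≤ L) {s s' : Fin 6} {i i' : ℕ} (hi : i < L) (hi' : i' < L)
    (h : s(segVertex L s i, segVertex L s (i + 1)) =
      s(segVertex L s' i', segVertex L s' (i' + 1))) : s = s' ∧ i = i' := by
  have key : s = s' := by
    rcases Sym2.eq_iff.1 h with ⟨h1, h2⟩ | ⟨h1, h2⟩ <;> rcases Nat.eq_zero_or_pos i with h0 | h0
    · exact (segVertex_inj (by omega) (by omega) (by omega) h2).1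
    · exact (segVertex_inj (by omega) (by omega) (by omega) h1).1
    · exact (segVertex_inj (by omega) (by omega) (by omega) h2).1
    · exact (segVertex_inj (by omega) (by omega) (by omega) h1).1
  subst key
  refine ⟨rfl, ?_⟩
  rcases Sym2.eq_iff.1 h with ⟨h1, h2⟩ | ⟨h1, h2⟩
  · exact segVertex_injOn (by omega) (by omega) h1
  · have := segVertex_injOn (by omega) (by omega) h1
    have := segVertex_injOn (by omega) (by omega) h2
    omega

end Structure


/-! ### The coloring with four colors, and bipartiteness. -/

section Upper

theorem exists_walk_of_adj {V : Type*} {G : SimpleGraph V} (w : ℕ → V) (n : ℕ) :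
    ∀ a : ℕ, (∀ t, a ≤ t → t < a + n → G.Adj (w t) (w (t + 1))) →
      ∃ p : G.Walk (w a) (w (a + n)), p.length = n ∧ ∀ i ≤ n, p.getVert i = w (a + i) := by
  induction n with
  | zero => exact fun a _ => ⟨SimpleGraph.Walk.nil, rfl, by simp⟩
  | succ n ih =>
    intro a h
    obtain ⟨p, hp, hv⟩ := ih (a + 1) fun t h1 h2 => h t (by omega) (by omega)
    have hadj := h a le_rfl (by omega)
    have e : a + 1 + n = a + (n + 1) := by omega
    refine ⟨(SimpleGraph.Walk.cons hadj p).copy rfl (congrArg w e), by simp [hp], ?_⟩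
    intro i hi
    rw [SimpleGraph.Walk.getVert_copy]
    rcases i with _ | i
    · simp
    · rw [SimpleGraph.Walk.getVert_cons_succ, hv i (by omega)]
      congr 1
      omega

theorem IsTotalProperPath.reverse {V α : Type*} {G : SimpleGraph V} {cv : V → α}
    {ce : Sym2 V → α} {u v : V} {p : G.Walk u v} (hp : IsTotalProperPath G cv ce p) :
    IsTotalProperPath G cv ce p.reverse := by
  have hl := p.length_reverse
  constructor
  · exact hp.isPath.reverse
  · intro i hi
    obtain ⟨m, hm⟩ : ∃ m, p.length = m + i + 2 := ⟨p.length - (i + 2), by omega⟩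
    simp only [SimpleGraph.Walk.getVert_reverse]
    rw [show p.length - i = m + 2 by omega, show p.length - (i + 1) = m + 1 by omega,
      show p.length - (i + 2) = m by omega,
      Sym2.eq_swap (a := p.getVert (m + 2)), Sym2.eq_swap (a := p.getVert (m + 1)) (b := p.getVert m)]
    exact (hp.edge_ne_edge m (by omega)).symm
  · intro i h0 hi
    obtain ⟨m, hm⟩ : ∃ m, p.length = m + i + 1 := ⟨p.length - (i + 1), by omega⟩
    simp only [SimpleGraph.Walk.getVert_reverse]
    rw [show p.length - i = m + 1 by omega, show p.length - (i + 1) = m by omega]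
    exact (hp.vert_ne_vert m (by omega) (by omega)).symm
  · intro i hi
    obtain ⟨m, hm⟩ : ∃ m, p.length = m + i + 2 := ⟨p.length - (i + 2), by omega⟩
    simp only [SimpleGraph.Walk.getVert_reverse]
    rw [show p.length - i = m + 2 by omega, show p.length - (i + 1) = m + 1 by omega,
      show p.length - (i + 2) = m by omega,
      Sym2.eq_swap (a := p.getVert (m + 2)), Sym2.eq_swap (a := p.getVert (m + 1)) (b := p.getVert m)]
    exact (hp.vert_ne_edge m (by omega)).symm

variable {L : ℕ}

/-- The vertex coloring by the colors `2` and `3`, according to the parity of the position. -/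
def earVertexColor (L : ℕ) : EarVertex L → Fin 4 :=
  Sum.elim (fun _ => 2) fun x => if (x.2 : ℕ) % 2 = 1 then 2 else 3

open Classical in
/-- The edge coloring by the colors `0` and `1`, alternating along each segment and starting
with `0`. -/
noncomputable def earEdgeColor (L : ℕ) (e : Sym2 (EarVertex L)) : Fin 4 :=
  if ∃ (s : Fin 6) (i : ℕ), i < L ∧ i % 2 = 0 ∧ e = s(segVertex L s i, segVertex L s (i + 1))
  then 0 else 1

theorem earVertexColor_segVertex (hL : L % 2 = 0) {i : ℕ} (hi : i ≤ L) (s : Fin 6) :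
    earVertexColor L (segVertex L s i) = if i % 2 = 0 then 2 else 3 := by
  rcases Nat.eq_zero_or_pos i with rfl | h0
  · simp [segVertex_zero, earVertexColor]
  rcases hi.eq_or_lt with rfl | hi
  · simp [segVertex_last h0, earVertexColor, hL]
  · rw [segVertex_interior h0 hi]
    have : (i - 1) % 2 = 1 ↔ i % 2 = 0 := by omega
    simp [earVertexColor, this]

theorem earEdgeColor_segVertex (hL : 3 ≤ L) {i : ℕ} (hi : i < L) (s : Fin 6) :
    earEdgeColor L s(segVertex L s i, segVertex L s (i + 1)) = if i % 2 = 0 then 0 else 1 := by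
  unfold earEdgeColor
  congr 1
  refine propext ⟨?_, fun h => ⟨s, i, hi, h, rfl⟩⟩
  rintro ⟨s', i', hi', h0, h⟩
  rwa [(segEdge_inj hL hi hi' h).2]

theorem earVertexColor_cases (v : EarVertex L) :
    earVertexColor L v = 2 ∨ earVertexColor L v = 3 := by
  rcases v with m | x
  · simp [earVertexColor]
  · simp only [earVertexColor, Sum.elim_inr]
    split_ifs <;> simp

theorem earEdgeColor_cases (e : Sym2 (EarVertex L)) :
    earEdgeColor L e = 0 ∨ earEdgeColor L e = 1 := by
  unfold earEdgeColor
  split_ifs <;> simp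

theorem earVertexColor_ne_earEdgeColor (v : EarVertex L) (e : Sym2 (EarVertex L)) :
    earVertexColor L v ≠ earEdgeColor L e := by
  rcases earVertexColor_cases v with h | h <;> rcases earEdgeColor_cases e with h' | h' <;>
    rw [h, h'] <;> decide

theorem earVertexColor_ne_of_adj (hL : L % 2 = 0) {x y : EarVertex L}
    (h : (cycleWithTwoEars L).Adj x y) : earVertexColor L x ≠ earVertexColor L y := by
  have key : ∀ (s : Fin 6) (i : ℕ), i < L →
      earVertexColor L (segVertex L s i) ≠ earVertexColor L (segVertex L s (i + 1)) := by
    intro s i hi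
    rw [earVertexColor_segVertex hL hi.le, earVertexColor_segVertex hL hi]
    rcases Nat.mod_two_eq_zero_or_one i with h | h
    · rw [if_pos h, if_neg (by omega)]; decide
    · rw [if_neg (by omega), if_pos (by omega)]; decide
  obtain ⟨s, i, hi, ⟨rfl, rfl⟩ | ⟨rfl, rfl⟩⟩ := exists_of_adj h
  · exact key s i hi
  · exact (key s i hi).symm

theorem cycleWithTwoEars_isBipartite (hL : L % 2 = 0) : (cycleWithTwoEars L).IsBipartite := by
  have C : (cycleWithTwoEars L).Coloring Bool :=
    SimpleGraph.Coloring.mk (fun v => decide (earVertexColor L v = 2)) fun {x y} h => by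
      have := earVertexColor_ne_of_adj hL h
      rcases earVertexColor_cases x with h1 | h1 <;> rcases earVertexColor_cases y with h2 | h2 <;>
        simp_all
  simpa using C.colorable

/-- The vertices in the order in which they are met along the segments `q 0, q 1, …`. -/
def routeVertex (L : ℕ) (q : ℕ → Fin 6) (t : ℕ) : EarVertex L := segVertex L (q (t / L)) (t % L)

/-- The segments `q 0, …, q 4` are distinct and can be traversed in this order, without meeting
a junction twice in between. -/
structure IsRoute (q : ℕ → Fin 6) : Prop where
  inj : ∀ i < 5, ∀ j < 5, q i = q j → i = j
  link : ∀ i < 4, segStart (q (i + 1)) = segEnd (q i)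
  inj_start : ∀ i < 5, ∀ j < 5, 0 < i → 0 < j → segStart (q i) = segStart (q j) → i = j
  surj_start : ∀ m : Fin 4, ∃ i < 5, 0 < i ∧ segStart (q i) = m

theorem routeVertex_succ (hL : 0 < L) {q : ℕ → Fin 6} (hq : IsRoute q) {t : ℕ}
    (ht : t + 1 < 5 * L) :
    routeVertex L q (t + 1) = segVertex L (q (t / L)) (t % L + 1) := by
  unfold routeVertex
  have hm := Nat.mod_lt t hL
  have hd := Nat.div_add_mod t L
  rcases (show t % L + 1 ≤ L by omega).eq_or_lt with h | h
  · have e : t + 1 = L * (t / L + 1) := by rw [mul_add]; omega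
    have hk : t / L < 4 := by
      by_contra hc
      have : L * (t / L + 1) ≥ L * 5 := Nat.mul_le_mul_left _ (by omega)
      omega
    have e1 : (t + 1) / L = t / L + 1 := by
      rw [e, Nat.mul_div_cancel_left _ hL]
    have e2 : (t + 1) % L = 0 := by rw [e, Nat.mul_mod_right]
    rw [e1, e2, h, segVertex_zero, segVertex_last hL, hq.link _ hk]
  · have e : t + 1 = (t % L + 1) + L * (t / L) := by omega
    have e1 : (t + 1) / L = t / L := by
      rw [e, Nat.add_mul_div_left _ _ hL, Nat.div_eq_of_lt h, zero_add]
    have e2 : (t + 1) % L = t % L + 1 := by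
      rw [e, Nat.add_mul_mod_self_left, Nat.mod_eq_of_lt h]
    rw [e1, e2]

/-- The positions `0` and `5 * L` must be excluded: five segments pass six junction positions, but
there are only four junctions, and only the four inner positions are distinct. -/
theorem routeVertex_inj (hL : 0 < L) {q : ℕ → Fin 6} (hq : IsRoute q) {t t' : ℕ} (h0 : 0 < t)
    (ht : t < 5 * L) (h0' : 0 < t') (ht' : t' < 5 * L)
    (h : routeVertex L q t = routeVertex L q t') : t = t' := by
  unfold routeVertex at h
  have hm := Nat.mod_lt t hL
  have hm' := Nat.mod_lt t' hL
  have hd := Nat.div_add_mod t L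
  have hd' := Nat.div_add_mod t' L
  have hk : t / L < 5 := Nat.div_lt_of_lt_mul (by rwa [mul_comm])
  have hk' : t' / L < 5 := Nat.div_lt_of_lt_mul (by rwa [mul_comm])
  have fin : t / L = t' / L → t % L = t' % L → t = t' := by
    intro h1 h2
    rw [← hd, ← hd', h1, h2]
  rcases Nat.eq_zero_or_pos (t % L) with h1 | h1
  · rcases Nat.eq_zero_or_pos (t' % L) with h2 | h2
    · rw [h1, h2, segVertex_zero, segVertex_zero, Sum.inl.injEq] at h
      have p : 0 < t / L := by
        rcases Nat.eq_zero_or_pos (t / L) with h3 | h3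
        · rw [h3, h1] at hd; omega
        · exact h3
      have p' : 0 < t' / L := by
        rcases Nat.eq_zero_or_pos (t' / L) with h3 | h3
        · rw [h3, h2] at hd'; omega
        · exact h3
      exact fin (hq.inj_start _ hk _ hk' p p' h) (h1.trans h2.symm)
    · have := segVertex_inj h2 hm' hm.le h.symm
      omega
  · have := segVertex_inj h1 hm hm'.le h
    exact fin (hq.inj _ hk _ hk' this.1) this.2

theorem exists_routeVertex (hL : 0 < L) {q : ℕ → Fin 6} (hq : IsRoute q) (v : EarVertex L)
    (hv : ∀ s i, v = Sum.inr (s, i) → ∃ k < 5, q k = s) :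
    ∃ t, 0 < t ∧ t < 5 * L ∧ routeVertex L q t = v := by
  rcases v with m | ⟨s, i⟩
  · obtain ⟨k, hk, h0, hm⟩ := hq.surj_start m
    refine ⟨k * L, by positivity, Nat.mul_lt_mul_of_pos_right hk hL, ?_⟩
    simp [routeVertex, hL, segVertex_zero, hm]
  · obtain ⟨k, hk, rfl⟩ := hv s i rfl
    have hi : (i : ℕ) + 1 < L := by omega
    refine ⟨(i + 1) + L * k, by omega, ?_, ?_⟩
    · have : L * (k + 1) ≤ L * 5 := Nat.mul_le_mul_left _ hk
      rw [mul_add] at this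
      omega
    · rw [routeVertex, Nat.add_mul_div_left _ _ hL, Nat.div_eq_of_lt hi, zero_add,
        Nat.add_mul_mod_self_left, Nat.mod_eq_of_lt hi, segVertex_interior (by omega) hi]
      simp

/-- Since `L` is even, `t` and `t % L` have the same parity, so the alternation is not disturbed
where two segments meet. -/
theorem earEdgeColor_routeVertex (hL : 3 ≤ L) (h2 : L % 2 = 0) {q : ℕ → Fin 6} (hq : IsRoute q)
    {t : ℕ} (ht : t + 1 < 5 * L) :
    earEdgeColor L s(routeVertex L q t, routeVertex L q (t + 1)) = if t % 2 = 0 then 0 else 1 := by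
  have hm := Nat.mod_lt t (show 0 < L by omega)
  rw [routeVertex_succ (by omega) hq ht, routeVertex, earEdgeColor_segVertex hL hm,
    Nat.mod_mod_of_dvd t (Nat.dvd_of_mod_eq_zero h2)]

theorem exists_isTotalProperPath_route (hL : 3 ≤ L) (h2 : L % 2 = 0) {q : ℕ → Fin 6}
    (hq : IsRoute q) {a b : ℕ} (h0 : 0 < a) (hab : a ≤ b) (hb : b < 5 * L) :
    ∃ p : (cycleWithTwoEars L).Walk (routeVertex L q a) (routeVertex L q b),
      IsTotalProperPath _ (earVertexColor L) (earEdgeColor L) p := by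
  have adj : ∀ t, t + 1 < 5 * L →
      (cycleWithTwoEars L).Adj (routeVertex L q t) (routeVertex L q (t + 1)) := by
    intro t ht
    rw [routeVertex_succ (by omega) hq ht]
    exact adj_segVertex _ (Nat.mod_lt t (by omega))
  obtain ⟨n, rfl⟩ := Nat.exists_eq_add_of_le hab
  obtain ⟨p, hp, hv⟩ := exists_walk_of_adj (G := cycleWithTwoEars L) (routeVertex L q) n a
    fun t _ ht => adj t (by omega)
  refine ⟨p, ?_, ?_, ?_, ?_⟩
  · rw [← SimpleGraph.Walk.IsPath.getVert_injOn_iff]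
    intro i hi j hj hij
    simp only [Set.mem_ofPred_eq, hp] at hi hj
    rw [hv i hi, hv j hj] at hij
    have := routeVertex_inj (by omega) hq (by omega) (by omega) (by omega) (by omega) hij
    omega
  · intro i hi
    rw [hv i (by omega), hv (i + 1) (by omega), hv (i + 2) (by omega)]
    have e1 := earEdgeColor_routeVertex hL h2 hq (t := a + i) (by omega)
    have e2 := earEdgeColor_routeVertex hL h2 hq (t := a + (i + 1)) (by omega)
    rw [show a + (i + 1) = a + i + 1 by omega] at *
    rw [show a + (i + 2) = a + i + 1 + 1 by omega, e1, e2]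
    rcases Nat.mod_two_eq_zero_or_one (a + i) with h | h
    · rw [if_pos h, if_neg (by omega)]; decide
    · rw [if_neg (by omega), if_pos (by omega)]; decide
  · intro i _ hi
    exact earVertexColor_ne_of_adj h2 (p.adj_getVert_succ (by omega))
  · intro i _
    exact ⟨earVertexColor_ne_earEdgeColor _ _, earVertexColor_ne_earEdgeColor _ _⟩

theorem exists_isTotalProperPath_of_route (hL : 3 ≤ L) (h2 : L % 2 = 0) {q : ℕ → Fin 6}
    (hq : IsRoute q) {x y : EarVertex L} (hx : ∀ s i, x = Sum.inr (s, i) → ∃ k < 5, q k = s)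
    (hy : ∀ s i, y = Sum.inr (s, i) → ∃ k < 5, q k = s) :
    ∃ p : (cycleWithTwoEars L).Walk x y,
      IsTotalProperPath _ (earVertexColor L) (earEdgeColor L) p := by
  obtain ⟨a, ha, ha', rfl⟩ := exists_routeVertex (by omega) hq x hx
  obtain ⟨b, hb, hb', rfl⟩ := exists_routeVertex (by omega) hq y hy
  rcases le_total a b with hab | hab
  · exact exists_isTotalProperPath_route hL h2 hq ha hab hb'
  · obtain ⟨p, hp⟩ := exists_isTotalProperPath_route hL h2 hq hb hab ha'
    exact ⟨p.reverse, hp.reverse⟩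

theorem isRoute_of_list {l : List (Fin 6)}
    (h : l = [4, 1, 2, 3, 0] ∨ l = [4, 1, 5, 3, 0] ∨ l = [2, 3, 0, 1, 5]) :
    IsRoute fun k => l.getD k 0 := by
  rcases h with rfl | rfl | rfl <;> constructor <;> decide

/-- The three routes omit the segments `5`, `2` and `4` respectively, so for any two segments one of
the routes omits neither. -/
theorem exists_route (s s' : Fin 6) :
    ∃ q : ℕ → Fin 6, IsRoute q ∧ (∃ k < 5, q k = s) ∧ ∃ k < 5, q k = s' := by
  have key : ∀ s s' : Fin 6, ∃ l ∈ [[4, 1, 2, 3, 0], [4, 1, 5, 3, 0], [2, 3, 0, 1, 5]],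
      (∃ k < 5, l.getD k 0 = s) ∧ ∃ k < 5, l.getD k 0 = s' := by decide
  obtain ⟨l, hl, h⟩ := key s s'
  exact ⟨fun k => l.getD k 0, isRoute_of_list (by simpa using hl), h⟩

theorem isTotalProperConnected_earColor (hL : 3 ≤ L) (h2 : L % 2 = 0) :
    IsTotalProperConnected (cycleWithTwoEars L) (earVertexColor L) (earEdgeColor L) := by
  intro x y
  have aux : ∀ v : EarVertex L, ∃ s₀ : Fin 6, ∀ s i, v = Sum.inr (s, i) → s₀ = s := by
    rintro (m | ⟨s, i⟩)
    · exact ⟨0, by simp⟩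
    · exact ⟨s, by simp⟩
  obtain ⟨s, hs⟩ := aux x
  obtain ⟨s', hs'⟩ := aux y
  obtain ⟨q, hq, h, h'⟩ := exists_route s s'
  exact exists_isTotalProperPath_of_route hL h2 hq
    (fun t i ht => hs t i ht ▸ h) (fun t i ht => hs' t i ht ▸ h')

end Upper

/-! ### 2-connectedness. -/

section TwoConnected

variable {L : ℕ}

theorem reachable_segVertex {v : EarVertex L} {s : Fin 6} {a : ℕ} (n : ℕ)
    (hn : a + n ≤ L) (h : ∀ i, a ≤ i → i ≤ a + n → segVertex L s i ∈ ({v}ᶜ : Set (EarVertex L))) :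
    ((cycleWithTwoEars L).induce {v}ᶜ).Reachable
      ⟨segVertex L s a, h a le_rfl (by omega)⟩ ⟨segVertex L s (a + n), h _ (by omega) le_rfl⟩ := by
  induction n with
  | zero => exact SimpleGraph.Reachable.refl _
  | succ n ih =>
    refine (ih (by omega) fun i h1 h2 => h i h1 (by omega)).trans (SimpleGraph.Adj.reachable ?_)
    exact adj_segVertex s (by omega)

/-- Every remaining vertex can walk along its segment to a junction on the side away from `v`. If
`v` is a junction, the other three lie on a path of the cycle. If `v` is inside a segment, that
segment is bypassed by its parallel ear or by the rest of the cycle. -/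
theorem connected_induce_compl_singleton (hL : 0 < L) (v : EarVertex L) :
    ((cycleWithTwoEars L).induce {v}ᶜ).Connected := by
  classical
  let R : EarVertex L → EarVertex L → Prop := fun x y =>
    ∃ (hx : x ∈ ({v}ᶜ : Set (EarVertex L))) (hy : y ∈ ({v}ᶜ : Set (EarVertex L))),
      ((cycleWithTwoEars L).induce {v}ᶜ).Reachable ⟨x, hx⟩ ⟨y, hy⟩
  have symm : ∀ {x y}, R x y → R y x := fun ⟨hx, hy, h⟩ => ⟨hy, hx, h.symm⟩
  have trans : ∀ {x y z}, R x y → R y z → R x z := fun ⟨hx, _, h⟩ ⟨_, hz, h'⟩ =>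
    ⟨hx, hz, h.trans h'⟩
  have refl : ∀ {x}, x ≠ v → R x x := fun hx => ⟨hx, hx, SimpleGraph.Reachable.refl _⟩
  have seg : ∀ s a b, a ≤ b → b ≤ L → (∀ i, a ≤ i → i ≤ b → segVertex L s i ≠ v) →
      R (segVertex L s a) (segVertex L s b) := by
    intro s a b hab hb h
    obtain ⟨n, rfl⟩ := Nat.exists_eq_add_of_le hab
    exact ⟨_, _, reachable_segVertex n hb h⟩
  have full : ∀ s, (∀ i ≤ L, segVertex L s i ≠ v) →
      R (Sum.inl (segStart s)) (Sum.inl (segEnd s)) := by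
    intro s h
    have := seg s 0 L (by omega) le_rfl fun i _ hi => h i hi
    rwa [segVertex_zero, segVertex_last hL] at this
  have toJunction : ∀ x, x ≠ v → ∃ m : Fin 4, R x (Sum.inl m) := by
    intro x hx
    obtain ⟨s, j, hj, rfl⟩ := exists_segVertex hL x
    by_cases h : ∃ i, i ≤ j ∧ segVertex L s i = v
    · obtain ⟨i, hi, rfl⟩ := h
      refine ⟨segEnd s, ?_⟩
      rw [← segVertex_last hL]
      refine seg s j L hj le_rfl fun k hk hkL hki => ?_
      have := segVertex_injOn hkL (hi.trans hj) hki
      have : i = j := by omega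
      exact hx (by rw [this])
    · push Not at h
      refine ⟨segStart s, ?_⟩
      rw [← segVertex_zero]
      exact symm (seg s 0 j (by omega) hj fun i _ hi => h i hi)
  have junctions : ∀ m m' : Fin 4, (Sum.inl m : EarVertex L) ≠ v → (Sum.inl m' : EarVertex L) ≠ v →
      R (Sum.inl m) (Sum.inl m') := by
    rcases v with u | ⟨s, i⟩
    · have hs : ∀ s, segStart s ≠ u → segEnd s ≠ u →
          R (Sum.inl (segStart s)) (Sum.inl (segEnd s)) := by
        intro s h1 h2
        refine full s fun i hi h => ?_
        rcases segVertex_eq_inl hL hi h with h | h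
        · exact h1 h.2
        · exact h2 h.2
      have h0 := hs 0
      have h1 := hs 1
      have h2 := hs 2
      have h3 := hs 3
      simp only [segStart, segEnd, Matrix.cons_val] at h0 h1 h2 h3
      intro m m' hm hm'
      fin_cases u <;> fin_cases m <;> fin_cases m' <;>
        first
        | exact absurd rfl hm
        | exact absurd rfl hm'
        | exact refl hm
        | exact h0 (by decide) (by decide)
        | exact h1 (by decide) (by decide)
        | exact h2 (by decide) (by decide)
        | exact h3 (by decide) (by decide)
        | exact symm (h0 (by decide) (by decide))
        | exact symm (h1 (by decide) (by decide))
        | exact symm (h2 (by decide) (by decide))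
        | exact symm (h3 (by decide) (by decide))
        | exact trans (h0 (by decide) (by decide)) (h1 (by decide) (by decide))
        | exact trans (h1 (by decide) (by decide)) (h2 (by decide) (by decide))
        | exact trans (h2 (by decide) (by decide)) (h3 (by decide) (by decide))
        | exact trans (h3 (by decide) (by decide)) (h0 (by decide) (by decide))
        | exact symm (trans (h0 (by decide) (by decide)) (h1 (by decide) (by decide)))
        | exact symm (trans (h1 (by decide) (by decide)) (h2 (by decide) (by decide)))
        | exact symm (trans (h2 (by decide) (by decide)) (h3 (by decide) (by decide)))
        | exact symm (trans (h3 (by decide) (by decide)) (h0 (by decide) (by decide)))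
    · have hs : ∀ t, t ≠ s → R (Sum.inl (segStart t)) (Sum.inl (segEnd t)) := by
        intro t ht
        refine full t fun j hj h => ht ?_
        have hi : (i : ℕ) + 1 < L := by omega
        have e : segVertex L s (i + 1) = Sum.inr (s, i) := by
          rw [segVertex_interior (by omega) hi]; simp
        exact (segVertex_inj (by omega) hi hj (e.trans h.symm)).1.symm
      have h01 : R (Sum.inl 0) (Sum.inl 1) := by
        by_cases h : (0 : Fin 6) = s
        · exact hs 4 (by subst h; decide)
        · exact hs 0 h
      have h23 : R (Sum.inl 2) (Sum.inl 3) := by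
        by_cases h : (2 : Fin 6) = s
        · exact hs 5 (by subst h; decide)
        · exact hs 2 h
      have h02 : R (Sum.inl 0) (Sum.inl 2) := by
        by_cases h : (1 : Fin 6) = s
        · have h30 := hs 3 (by subst h; decide)
          exact symm (trans h23 h30)
        · exact trans h01 (hs 1 h)
      have h0 : ∀ m : Fin 4, R (Sum.inl 0) (Sum.inl m) := by
        intro m
        fin_cases m
        · exact refl (by simp)
        · exact h01
        · exact h02
        · exact trans h02 h23
      exact fun m m' _ _ => trans (symm (h0 m)) (h0 m')
  have : Nonempty ({v}ᶜ : Set (EarVertex L)) := by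
    by_cases h : v = Sum.inl 0
    · exact ⟨⟨Sum.inl 1, by simp [h]⟩⟩
    · exact ⟨⟨Sum.inl 0, fun h' => h h'.symm⟩⟩
  refine ⟨fun x y => ?_⟩
  obtain ⟨m, hm⟩ := toJunction x.1 x.2
  obtain ⟨m', hm'⟩ := toJunction y.1 y.2
  obtain ⟨_, hmv, _⟩ := id hm
  obtain ⟨_, hmv', _⟩ := id hm'
  obtain ⟨_, _, h⟩ := trans hm (trans (junctions m m' hmv hmv') (symm hm'))
  exact h

theorem isTwoConnected_cycleWithTwoEars (hL : 3 ≤ L) (h2 : L % 2 = 0) :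
    IsTwoConnected (cycleWithTwoEars L) := by
  refine ⟨?_, ?_, connected_induce_compl_singleton (by omega)⟩
  · have : Nonempty (EarVertex L) := ⟨Sum.inl 0⟩
    exact ⟨fun x y => (isTotalProperConnected_earColor hL h2 x y).choose.reachable⟩
  · simp [Nat.card_eq_fintype_card]
    omega

end TwoConnected


/-! ### Colorings with three colors as directed graphs. -/

section Arrows

variable {V : Type*} {G : SimpleGraph V}

theorem IsTotalProperConnected.comp_injective {α β : Type*} {cv : V → α} {ce : Sym2 V → α}
    {f : α → β} (hf : Function.Injective f) (h : IsTotalProperConnected G cv ce) :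
    IsTotalProperConnected G (f ∘ cv) (f ∘ ce) := by
  intro u v
  obtain ⟨p, hp⟩ := h u v
  exact ⟨p, hp.isPath, fun i hi => hf.ne (hp.edge_ne_edge i hi),
    fun i h0 hi => hf.ne (hp.vert_ne_vert i h0 hi),
    fun i hi => ⟨hf.ne (hp.vert_ne_edge i hi).1, hf.ne (hp.vert_ne_edge i hi).2⟩⟩

/-- The vertices and edges met along a sequence of vertices: the vertex `w i` has position `2 * i`
and the edge from `w i` to `w (i + 1)` has position `2 * i + 1`. -/
def walkElem (w : ℕ → V) (j : ℕ) : V ⊕ Sym2 V :=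
  if j % 2 = 0 then Sum.inl (w (j / 2)) else Sum.inr s(w (j / 2), w (j / 2 + 1))

theorem walkElem_even (w : ℕ → V) (i : ℕ) : walkElem w (2 * i) = Sum.inl (w i) := by
  simp [walkElem]

theorem walkElem_odd (w : ℕ → V) (i : ℕ) :
    walkElem w (2 * i + 1) = Sum.inr s(w i, w (i + 1)) := by
  have h : (2 * i + 1) / 2 = i := by omega
  simp [walkElem, h, Nat.add_mod]

/-- Incidence of a vertex with an edge of `G`, or of an edge with a vertex. -/
def Incident (G : SimpleGraph V) : V ⊕ Sym2 V → V ⊕ Sym2 V → Prop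
  | Sum.inl v, Sum.inr e => v ∈ e ∧ e ∈ G.edgeSet
  | Sum.inr e, Sum.inl v => v ∈ e ∧ e ∈ G.edgeSet
  | _, _ => False

theorem Incident.symm {a b : V ⊕ Sym2 V} (h : Incident G a b) : Incident G b a := by
  rcases a with a | a <;> rcases b with b | b <;> exact h

theorem incident_walkElem {w : ℕ → V} {j : ℕ} (h : G.Adj (w (j / 2)) (w (j / 2 + 1))) :
    Incident G (walkElem w j) (walkElem w (j + 1)) := by
  obtain ⟨i, rfl | rfl⟩ := Nat.even_or_odd' j
  · rw [show 2 * i / 2 = i by omega] at h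
    rw [walkElem_even, walkElem_odd]
    exact ⟨Sym2.mem_mk_left _ _, h⟩
  · rw [show (2 * i + 1) / 2 = i by omega] at h
    rw [walkElem_odd, show 2 * i + 1 + 1 = 2 * (i + 1) by ring, walkElem_even]
    exact ⟨Sym2.mem_mk_right _ _, h⟩

/-- The vertices and edges of `G` form a directed graph: `a` points to `b` if they are incident and
the color of `b` is the successor of the color of `a`. -/
def Arrow (G : SimpleGraph V) (col : V ⊕ Sym2 V → ZMod 3) (a b : V ⊕ Sym2 V) : Prop :=
  Incident G a b ∧ col b = col a + 1

/-- Reachability along arrows. -/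
abbrev Reach (G : SimpleGraph V) (col : V ⊕ Sym2 V → ZMod 3) : V ⊕ Sym2 V → V ⊕ Sym2 V → Prop :=
  Relation.ReflTransGen (Arrow G col)

theorem Reach.mem_of_closed {col : V ⊕ Sym2 V → ZMod 3} {S : V ⊕ Sym2 V → Prop}
    (hS : ∀ a b, S a → Arrow G col a b → S b) {a b : V ⊕ Sym2 V} (ha : S a)
    (h : Reach G col a b) : S b := by
  induction h with
  | refl => exact ha
  | tail _ h ih => exact hS _ _ ih h

/-- Any two vertices are incident with edges one of which is reachable from the other. -/
def IncidentComparable (G : SimpleGraph V) (col : V ⊕ Sym2 V → ZMod 3) : Prop :=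
  ∀ x y : V, x ≠ y → ∃ e f, Incident G (Sum.inl x) e ∧ Incident G (Sum.inl y) f ∧
    (Reach G col e f ∨ Reach G col f e)

/-- The path is cut down to the elements from its first edge to its last, since its end vertices are
under no color condition. On these the color increment is constant, so they form a directed walk
forwards or backwards. -/
theorem IsTotalProperPath.exists_comparable {cv : V → ZMod 3} {ce : Sym2 V → ZMod 3} {x y : V}
    {p : G.Walk x y} (hp : IsTotalProperPath G cv ce p) (hxy : x ≠ y) :
    ∃ e f, Incident G (Sum.inl x) e ∧ Incident G (Sum.inl y) f ∧
      (Reach G (Sum.elim cv ce) e f ∨ Reach G (Sum.elim cv ce) f e) := by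
  obtain ⟨n, hn⟩ : ∃ n, p.length = n + 1 := by
    rcases Nat.eq_zero_or_pos p.length with h | h
    · exact absurd (SimpleGraph.Walk.eq_of_length_eq_zero h) hxy
    · exact ⟨p.length - 1, by omega⟩
  set q := walkElem p.getVert with hq
  set col : V ⊕ Sym2 V → ZMod 3 := Sum.elim cv ce with hcol
  have inc : ∀ j, j < 2 * n + 2 → Incident G (q j) (q (j + 1)) := fun j hj =>
    incident_walkElem (p.adj_getVert_succ (by omega))
  have ne1 : ∀ j, j + 1 < 2 * n + 1 → col (q (j + 1)) ≠ col (q (j + 2)) := by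
    intro j hj
    obtain ⟨i, rfl | rfl⟩ := Nat.even_or_odd' j
    · rw [show 2 * i + 2 = 2 * (i + 1) by ring, hq, walkElem_even, walkElem_odd]
      exact (hp.vert_ne_edge i (by omega)).1.symm
    · rw [show 2 * i + 1 + 1 = 2 * (i + 1) by ring, show 2 * i + 1 + 2 = 2 * (i + 1) + 1 by ring,
        hq, walkElem_even, walkElem_odd]
      exact (hp.vert_ne_edge i (by omega)).2
  have ne2 : ∀ j, j + 2 < 2 * n + 1 → col (q (j + 1)) ≠ col (q (j + 3)) := by
    intro j hj
    obtain ⟨i, rfl | rfl⟩ := Nat.even_or_odd' j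
    · rw [show 2 * i + 3 = 2 * (i + 1) + 1 by ring, hq, walkElem_odd, walkElem_odd]
      exact hp.edge_ne_edge i (by omega)
    · rw [show 2 * i + 1 + 1 = 2 * (i + 1) by ring, show 2 * i + 1 + 3 = 2 * (i + 2) by ring,
        hq, walkElem_even, walkElem_even]
      exact hp.vert_ne_vert (i + 1) (by omega) (by omega)
  -- Three distinct elements of `ZMod 3` form an arithmetic progression with difference `1` or `-1`.
  have arith : ∀ a b c : ZMod 3, a ≠ b → b ≠ c → a ≠ c → c - b = b - a := by decide
  have arith' : ∀ a b : ZMod 3, a ≠ b → b = a + 1 ∨ a = b + 1 := by decide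
  have hconst : ∀ j, j + 1 < 2 * n + 1 → col (q (j + 2)) - col (q (j + 1)) =
      col (q 2) - col (q 1) := by
    intro j
    induction j with
    | zero => exact fun _ => rfl
    | succ j ih =>
      intro hj
      rw [← ih (by omega)]
      exact arith _ _ _ (ne1 j (by omega)) (ne1 (j + 1) (by omega)) (ne2 j (by omega))
  refine ⟨q 1, q (2 * n + 1), ?_, ?_, ?_⟩
  · have := inc 0 (by omega)
    rwa [hq, show walkElem p.getVert 0 = Sum.inl x by simp [walkElem]] at this
  · have := (inc (2 * n + 1) (by omega)).symm
    rw [show q (2 * n + 1 + 1) = Sum.inl y by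
      rw [show 2 * n + 1 + 1 = 2 * (n + 1) by ring, hq, walkElem_even, ← hn, p.getVert_length]]
      at this
    exact this
  · rcases Nat.eq_zero_or_pos n with rfl | h0
    · exact Or.inl Relation.ReflTransGen.refl
    rcases arith' _ _ (ne1 0 (by omega)) with h | h
    · left
      have : ∀ m, m < 2 * n + 1 → Reach G col (q 1) (q (m + 1)) := by
        intro m
        induction m with
        | zero => exact fun _ => Relation.ReflTransGen.refl
        | succ m ih =>
          intro hm
          refine (ih (by omega)).tail ⟨inc _ (by omega), ?_⟩
          have := hconst m hm
          linear_combination this + h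
      exact this (2 * n) (by omega)
    · right
      have : ∀ m, m < 2 * n + 1 → Reach G col (q (m + 1)) (q 1) := by
        intro m
        induction m with
        | zero => exact fun _ => Relation.ReflTransGen.refl
        | succ m ih =>
          intro hm
          refine (ih (by omega)).head ⟨(inc _ (by omega)).symm, ?_⟩
          have := hconst m hm
          linear_combination h - this
      exact this (2 * n) (by omega)

theorem IsTotalProperConnected.incidentComparable {cv : V → ZMod 3} {ce : Sym2 V → ZMod 3}
    (h : IsTotalProperConnected G cv ce) : IncidentComparable G (Sum.elim cv ce) := by
  intro x y hxy
  obtain ⟨p, hp⟩ := h x y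
  exact hp.exists_comparable hxy

end Arrows

/-! ### Directed segments and incidences along them. -/

section Darts

variable {L : ℕ}

/-- The vertices and edges of a segment, traversed from its start (`true`) or from its
end (`false`). -/
def dartElem (L : ℕ) (d : Fin 6 × Bool) (j : ℕ) : EarVertex L ⊕ Sym2 (EarVertex L) :=
  walkElem (segVertex L d.1) (if d.2 then j else 2 * L - j)

/-- The junction at which a directed segment starts. -/
def dartStart (d : Fin 6 × Bool) : Fin 4 := if d.2 then segStart d.1 else segEnd d.1

/-- The directed segment traversed the other way. -/
def dartRev (d : Fin 6 × Bool) : Fin 6 × Bool := (d.1, !d.2)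

theorem dartRev_dartRev (d : Fin 6 × Bool) : dartRev (dartRev d) = d := by
  simp [dartRev]

theorem dartElem_dartRev (d : Fin 6 × Bool) {j : ℕ} (hj : j ≤ 2 * L) :
    dartElem L (dartRev d) j = dartElem L d (2 * L - j) := by
  obtain ⟨s, _ | _⟩ := d
  · simp [dartElem, dartRev, Nat.sub_sub_self hj]
  · simp [dartElem, dartRev]

theorem dartElem_zero (hL : 0 < L) (d : Fin 6 × Bool) :
    dartElem L d 0 = Sum.inl (Sum.inl (dartStart d)) := by
  obtain ⟨s, _ | _⟩ := d
  · simp [dartElem, dartStart, walkElem_even, segVertex_last hL]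
  · simp [dartElem, dartStart, walkElem, segVertex_zero]

theorem dartElem_last (hL : 0 < L) (d : Fin 6 × Bool) :
    dartElem L d (2 * L) = Sum.inl (Sum.inl (dartStart (dartRev d))) := by
  rw [← dartElem_zero hL, dartElem_dartRev d (by omega), Nat.sub_zero]

theorem walkElem_segVertex_inj (hL : 3 ≤ L) {s s' : Fin 6} {j j' : ℕ} (h0 : 0 < j)
    (hj : j < 2 * L) (hj' : j' ≤ 2 * L)
    (h : walkElem (segVertex L s) j = walkElem (segVertex L s') j') : s = s' ∧ j = j' := by
  obtain ⟨i, rfl | rfl⟩ := Nat.even_or_odd' j <;> obtain ⟨i', rfl | rfl⟩ := Nat.even_or_odd' j'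
  · rw [walkElem_even, walkElem_even, Sum.inl.injEq] at h
    have := segVertex_inj (by omega) (by omega) (by omega) h
    exact ⟨this.1, by omega⟩
  · simp [walkElem_even, walkElem_odd] at h
  · simp [walkElem_even, walkElem_odd] at h
  · rw [walkElem_odd, walkElem_odd, Sum.inr.injEq] at h
    have := segEdge_inj hL (by omega) (by omega) h
    exact ⟨this.1, by omega⟩

theorem dartElem_inj (hL : 3 ≤ L) {d d' : Fin 6 × Bool} {j j' : ℕ} (h0 : 0 < j)
    (hj : j < 2 * L) (hj' : j' ≤ 2 * L) (h : dartElem L d j = dartElem L d' j') :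
    (d' = d ∧ j' = j) ∨ (d' = dartRev d ∧ j' = 2 * L - j) := by
  have key := walkElem_segVertex_inj hL (by split_ifs <;> omega) (by split_ifs <;> omega)
    (by split_ifs <;> omega) h
  obtain ⟨s, b⟩ := d
  obtain ⟨s', b'⟩ := d'
  obtain ⟨rfl, h⟩ := key
  cases b <;> cases b' <;> simp [dartRev] at h ⊢ <;> omega

theorem incident_walkElem_segVertex {s : Fin 6} {j : ℕ} (h0 : 0 < j)
    (hj : j < 2 * L) {y : EarVertex L ⊕ Sym2 (EarVertex L)}
    (h : Incident (cycleWithTwoEars L) (walkElem (segVertex L s) j) y) :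
    y = walkElem (segVertex L s) (j - 1) ∨ y = walkElem (segVertex L s) (j + 1) := by
  obtain ⟨i, rfl | rfl⟩ := Nat.even_or_odd' j
  · rw [walkElem_even] at h
    rcases y with y | e
    · exact h.elim
    obtain ⟨i, rfl⟩ : ∃ i', i = i' + 1 := ⟨i - 1, by omega⟩
    rw [show 2 * (i + 1) - 1 = 2 * i + 1 by omega, walkElem_odd, walkElem_odd]
    obtain ⟨h1, h2⟩ := h
    obtain ⟨z, rfl⟩ := h1
    rw [SimpleGraph.mem_edgeSet] at h2
    obtain ⟨s', i', hi', ⟨h3, h4⟩ | ⟨h3, h4⟩⟩ := exists_of_adj h2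
    · obtain ⟨rfl, h5⟩ := segVertex_inj (by omega) (by omega) (by omega) h3
      right
      rw [h4, ← h5]
    · obtain ⟨rfl, h5⟩ := segVertex_inj (by omega) (by omega) (by omega) h4
      left
      rw [h3, show i' = i by omega, Sym2.eq_swap]
  · rw [walkElem_odd] at h
    rcases y with y | e
    · rw [show 2 * i + 1 - 1 = 2 * i by omega, show 2 * i + 1 + 1 = 2 * (i + 1) by ring,
        walkElem_even, walkElem_even, Sum.inl.injEq, Sum.inl.injEq]
      exact Sym2.mem_iff.1 h.1
    · exact h.elim

theorem incident_dartElem {d : Fin 6 × Bool} {j : ℕ} (h0 : 0 < j) (hj : j < 2 * L)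
    {y : EarVertex L ⊕ Sym2 (EarVertex L)}
    (h : Incident (cycleWithTwoEars L) (dartElem L d j) y) :
    y = dartElem L d (j - 1) ∨ y = dartElem L d (j + 1) := by
  obtain ⟨s, _ | _⟩ := d
  · have := incident_walkElem_segVertex (j := 2 * L - j) (by omega) (by omega) h
    rw [show 2 * L - j - 1 = 2 * L - (j + 1) by omega,
      show 2 * L - j + 1 = 2 * L - (j - 1) by omega] at this
    exact this.symm
  · exact incident_walkElem_segVertex h0 hj h

theorem incident_junction (hL : 0 < L) {m : Fin 4} {y : EarVertex L ⊕ Sym2 (EarVertex L)}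
    (h : Incident (cycleWithTwoEars L) (Sum.inl (Sum.inl m)) y) :
    ∃ d, dartStart d = m ∧ y = dartElem L d 1 := by
  rcases y with y | e
  · exact h.elim
  obtain ⟨h1, h2⟩ := h
  obtain ⟨z, rfl⟩ := h1
  rw [SimpleGraph.mem_edgeSet] at h2
  obtain ⟨s, i, hi, ⟨h3, h4⟩ | ⟨h3, h4⟩⟩ := exists_of_adj h2
  · rcases segVertex_eq_inl hL (by omega) h3.symm with ⟨rfl, rfl⟩ | ⟨h5, _⟩
    · refine ⟨(s, true), rfl, ?_⟩
      rw [h3, h4]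
      exact (walkElem_odd _ 0).symm
    · omega
  · rcases segVertex_eq_inl hL (by omega) h4.symm with ⟨h5, _⟩ | ⟨h5, rfl⟩
    · omega
    · refine ⟨(s, false), rfl, ?_⟩
      have : dartElem L (s, false) 1 = walkElem (segVertex L s) (2 * i + 1) := by
        rw [dartElem]
        congr 1
        simp only [Bool.false_eq_true, if_false]
        omega
      rw [this, walkElem_odd, ← h3, ← h4, Sym2.eq_swap]

theorem exists_dartElem_even (d : Fin 6 × Bool) (i : ℕ) :
    ∃ v : EarVertex L, dartElem L d (2 * i) = Sum.inl v := by
  obtain ⟨s, _ | _⟩ := d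
  · exact ⟨segVertex L s (L - i), by
      simp only [dartElem, Bool.false_eq_true, if_false]
      rw [← Nat.mul_sub, walkElem_even]⟩
  · exact ⟨_, walkElem_even _ _⟩

end Darts

/-! ### Three colors do not suffice. -/

section LowerBound

variable {L : ℕ} {col : EarVertex L ⊕ Sym2 (EarVertex L) → ZMod 3}

/-- The color increases by one between the positions `j` and `j + 1` of a directed segment. -/
def Up (col : EarVertex L ⊕ Sym2 (EarVertex L) → ZMod 3) (d : Fin 6 × Bool) (j : ℕ) : Prop :=
  col (dartElem L d (j + 1)) = col (dartElem L d j) + 1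

/-- The color decreases by one between the positions `j` and `j + 1` of a directed segment. -/
def Down (col : EarVertex L ⊕ Sym2 (EarVertex L) → ZMod 3) (d : Fin 6 × Bool) (j : ℕ) : Prop :=
  col (dartElem L d j) = col (dartElem L d (j + 1)) + 1

theorem not_up_and_down {d : Fin 6 × Bool} {j : ℕ} (h : Up col d j) (h' : Down col d j) :
    False := by
  have arith : ∀ a b : ZMod 3, b = a + 1 → a = b + 1 → False := by decide
  exact arith _ _ h h'

theorem up_neg {d : Fin 6 × Bool} {j : ℕ} : Up (-col) d j ↔ Down col d j := by
  have arith : ∀ a b : ZMod 3, -b = -a + 1 ↔ a = b + 1 := by decide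
  exact arith _ _

theorem down_neg {d : Fin 6 × Bool} {j : ℕ} : Down (-col) d j ↔ Up col d j := by
  have arith : ∀ a b : ZMod 3, -a = -b + 1 ↔ b = a + 1 := by decide
  exact arith _ _

theorem up_dartRev {d : Fin 6 × Bool} {j : ℕ} (hj : j < 2 * L) :
    Up col (dartRev d) j ↔ Down col d (2 * L - 1 - j) := by
  rw [Up, Down, dartElem_dartRev d (by omega), dartElem_dartRev d (by omega),
    show 2 * L - 1 - j + 1 = 2 * L - j by omega, show 2 * L - (j + 1) = 2 * L - 1 - j by omega]

theorem down_dartRev {d : Fin 6 × Bool} {j : ℕ} (hj : j < 2 * L) :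
    Down col (dartRev d) j ↔ Up col d (2 * L - 1 - j) := by
  rw [Up, Down, dartElem_dartRev d (by omega), dartElem_dartRev d (by omega),
    show 2 * L - 1 - j + 1 = 2 * L - j by omega, show 2 * L - (j + 1) = 2 * L - 1 - j by omega]

/-- Some segment is traversed by arrows from the junction `a` to the junction `b`. -/
def JunctionStep (col : EarVertex L ⊕ Sym2 (EarVertex L) → ZMod 3) (a b : Fin 4) : Prop :=
  ∃ d, dartStart d = a ∧ dartStart (dartRev d) = b ∧ ∀ j < 2 * L, Up col d j

/-- Going back at once would change the color by `r + r ≠ 0`, so a walk on the 4-cycle keeps its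
direction. After four steps it is back where it was, with color changed by `4 * r = r ≠ 0`. So walks
have at most three steps, and none of these closes up. -/
theorem not_transGen_cyclic_step (c : Fin 4 → ZMod 3) {r : ZMod 3} (hr : r ≠ 0) (a : Fin 4) :
    ¬ Relation.TransGen (fun x y : Fin 4 => (y = x + 1 ∨ x = y + 1) ∧ c y = c x + r) a a := by
  set S : Fin 4 → Fin 4 → Prop := fun x y => (y = x + 1 ∨ x = y + 1) ∧ c y = c x + r with hS
  have two : ∀ r x : ZMod 3, r ≠ 0 → x ≠ x + r + r := by decide
  have four : ∀ r x : ZMod 3, r ≠ 0 → x ≠ x + r + r + r + r := by decide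
  have turn : ∀ x y z : Fin 4, (y = x + 1 ∨ x = y + 1) → (z = y + 1 ∨ y = z + 1) → z ≠ x →
      z = y + (y - x) := by decide
  have straight : ∀ x y z, S x y → S y z → z = y + (y - x) := by
    intro x y z h1 h2
    refine turn x y z h1.1 h2.1 ?_
    rintro rfl
    have := h2.2
    rw [h1.2] at this
    exact two _ _ hr this
  have around : ∀ x y : Fin 4, y + (y - x) + (y + (y - x) - y) +
      (y + (y - x) + (y + (y - x) - y) - (y + (y - x))) = x := by decide
  have bounded : ∀ b, Relation.TransGen S a b → S a b ∨ (∃ x, S a x ∧ S x b) ∨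
      ∃ x y, S a x ∧ S x y ∧ S y b := by
    intro b h
    induction h with
    | single h => exact Or.inl h
    | tail _ h ih =>
      rcases ih with h1 | ⟨x, h1, h2⟩ | ⟨x, y, h1, h2, h3⟩
      · exact Or.inr (Or.inl ⟨_, h1, h⟩)
      · exact Or.inr (Or.inr ⟨_, _, h1, h2, h⟩)
      · exfalso
        have e := straight _ _ _ h3 h
        rw [straight _ _ _ h2 h3, straight _ _ _ h1 h2, around] at e
        subst e
        have := h.2
        rw [h3.2, h2.2, h1.2] at this
        exact four _ _ hr this
  have odd1 : ∀ x : Fin 4, ¬ (x = x + 1 ∨ x = x + 1) := by decide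
  have odd3 : ∀ x y z : Fin 4, (y = x + 1 ∨ x = y + 1) → (z = y + 1 ∨ y = z + 1) →
      ¬ (x = z + 1 ∨ z = x + 1) := by decide
  intro h
  rcases bounded a h with h | ⟨x, h1, h2⟩ | ⟨x, y, h1, h2, h3⟩
  · exact odd1 a h.1
  · have := h2.2
    rw [h1.2] at this
    exact two _ _ hr this
  · exact odd3 a x y h1.1 h2.1 h3.1

/-- Every segment, ears included, joins cyclically consecutive junctions, and traversing it adds `2
* L` to the color. -/
theorem not_transGen_junctionStep (hL : 0 < L) (h3 : ¬ 3 ∣ L) (a : Fin 4) :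
    ¬ Relation.TransGen (JunctionStep col) a a := by
  have hr : ((2 * L : ℕ) : ZMod 3) ≠ 0 := by
    rw [Ne, ZMod.natCast_eq_zero_iff]
    omega
  have adj : ∀ d, dartStart (dartRev d) = dartStart d + 1 ∨
      dartStart d = dartStart (dartRev d) + 1 := by decide
  refine fun h => not_transGen_cyclic_step (fun m => col (Sum.inl (Sum.inl m))) hr a
    (Relation.TransGen.mono ?_ _ _ h)
  rintro _ _ ⟨d, rfl, rfl, hd⟩
  refine ⟨adj d, ?_⟩
  have : ∀ j ≤ 2 * L, col (dartElem L d j) = col (dartElem L d 0) + (j : ZMod 3) := by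
    intro j
    induction j with
    | zero => simp
    | succ j ih =>
      intro hj
      rw [hd j hj, ih (by omega)]
      push_cast
      ring
  have h := this (2 * L) le_rfl
  rwa [dartElem_zero hL, dartElem_last hL] at h

/-- The positions that are reachable from the junction `m` by traversing some segments completely
and then a part of another one. -/
def ReachedFrom (col : EarVertex L ⊕ Sym2 (EarVertex L) → ZMod 3) (m : Fin 4)
    (y : EarVertex L ⊕ Sym2 (EarVertex L)) : Prop :=
  ∃ m', Relation.ReflTransGen (JunctionStep col) m m' ∧ (y = Sum.inl (Sum.inl m') ∨
    ∃ d j, 0 < j ∧ j < 2 * L ∧ dartStart d = m' ∧ y = dartElem L d j ∧ ∀ k < j, Up col d k)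

theorem ReachedFrom.arrow (hL : 3 ≤ L) {m : Fin 4} {y z : EarVertex L ⊕ Sym2 (EarVertex L)}
    (hy : ReachedFrom col m y) (h : Arrow (cycleWithTwoEars L) col y z) :
    ReachedFrom col m z := by
  obtain ⟨m', hm, rfl | ⟨d, j, h0, hj, rfl, rfl, hup⟩⟩ := hy
  · obtain ⟨d, rfl, rfl⟩ := incident_junction (by omega) h.1
    refine ⟨_, hm, Or.inr ⟨d, 1, one_pos, by omega, rfl, rfl, ?_⟩⟩
    intro k hk
    obtain rfl : k = 0 := by omega
    rw [Up, dartElem_zero (by omega)]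
    exact h.2
  · rcases incident_dartElem h0 hj h.1 with rfl | rfl
    · obtain ⟨j, rfl⟩ : ∃ i, j = i + 1 := ⟨j - 1, by omega⟩
      exact (not_up_and_down (hup j (by omega)) h.2).elim
    · have hup' : ∀ k < j + 1, Up col d k := by
        intro k hk
        rcases (show k ≤ j by omega).eq_or_lt with rfl | hk
        · exact h.2
        · exact hup k hk
      rcases (show j + 1 ≤ 2 * L by omega).eq_or_lt with hj' | hj'
      · rw [hj', dartElem_last (by omega)]
        exact ⟨_, hm.tail ⟨d, rfl, rfl, hj' ▸ hup'⟩, Or.inl rfl⟩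
      · exact ⟨_, hm, Or.inr ⟨d, j + 1, by omega, hj', rfl, rfl, hup'⟩⟩

/-- Arrows on both segments run towards the common junction. From inside `d` one can only leave
through it, and to get inside `d'` one must enter at the far end of `d'`. Traversing `d'` back to
the common junction would then close a directed cycle of junctions. -/
theorem not_reach_of_down (hL : 3 ≤ L) (h3 : ¬ 3 ∣ L) {d d' : Fin 6 × Bool} (hne : d.1 ≠ d'.1)
    (hs : dartStart d = dartStart d') (hd : ∀ j < 2 * L, Down col d j)
    (hd' : ∀ j < 2 * L, Down col d' j) {i i' : ℕ} (hi0 : 0 < i) (hi : i < 2 * L) (hi0' : 0 < i')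
    (hi' : i' < 2 * L) :
    ¬ Reach (cycleWithTwoEars L) col (dartElem L d i) (dartElem L d' i') := by
  intro h
  have key := Reach.mem_of_closed (S := fun y => (∃ k, 0 < k ∧ k < 2 * L ∧ y = dartElem L d k) ∨
    ReachedFrom col (dartStart d) y) ?_ (Or.inl ⟨i, hi0, hi, rfl⟩) h
  · rcases key with ⟨k, hk0, hk, e⟩ | ⟨m', hm, e | ⟨d'', j, h0, hj, rfl, e, hup⟩⟩
    · rcases dartElem_inj hL (by omega) (by omega) (by omega) e with ⟨rfl, _⟩ | ⟨rfl, _⟩ <;>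
        exact hne rfl
    · have : ∃ d₀, dartStart d₀ = m' := by
        clear hm e
        revert m'
        decide
      obtain ⟨d₀, rfl⟩ := this
      rw [← dartElem_zero (by omega)] at e
      rcases dartElem_inj hL (by omega) (by omega) (by omega) e with ⟨_, e'⟩ | ⟨_, e'⟩ <;> omega
    · rcases dartElem_inj hL (by omega) (by omega) (by omega) e with ⟨rfl, rfl⟩ | ⟨rfl, rfl⟩
      · exact not_up_and_down (hup 0 (by omega)) (hd' 0 (by omega))
      · refine not_transGen_junctionStep (by omega) h3 (dartStart d)
          (Relation.TransGen.tail' hm ⟨dartRev d', rfl, ?_, ?_⟩)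
        · rw [dartRev_dartRev, hs]
        · exact fun k hk => (up_dartRev hk).2 (hd' _ (by omega))
  · rintro a b (⟨k, hk0, hk, rfl⟩ | ha) hab
    · rcases incident_dartElem hk0 hk hab.1 with rfl | rfl
      · rcases Nat.eq_zero_or_pos (k - 1) with h0 | h0
        · right
          rw [h0, dartElem_zero (by omega)]
          exact ⟨_, Relation.ReflTransGen.refl, Or.inl rfl⟩
        · exact Or.inl ⟨k - 1, h0, by omega, rfl⟩
      · exact (not_up_and_down hab.2 (hd k hk)).elim
    · exact Or.inr (ha.arrow hL hab)

theorem IncidentComparable.exists_dartElem (hL : 3 ≤ L)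
    (hcol : IncidentComparable (cycleWithTwoEars L) col) {d d' : Fin 6 × Bool} (hne : d.1 ≠ d'.1)
    {i : ℕ} (h0 : 0 < i) (hi : i < L) :
    ∃ k k', (k = 2 * i - 1 ∨ k = 2 * i + 1) ∧ (k' = 2 * i - 1 ∨ k' = 2 * i + 1) ∧
      (Reach (cycleWithTwoEars L) col (dartElem L d k) (dartElem L d' k') ∨
        Reach (cycleWithTwoEars L) col (dartElem L d' k') (dartElem L d k)) := by
  obtain ⟨x, hx⟩ := exists_dartElem_even (L := L) d i
  obtain ⟨y, hy⟩ := exists_dartElem_even (L := L) d' i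
  have hxy : x ≠ y := by
    rintro rfl
    rcases dartElem_inj hL (by omega) (by omega) (by omega) (hx.trans hy.symm) with
      ⟨rfl, _⟩ | ⟨rfl, _⟩ <;> exact hne rfl
  obtain ⟨e, f, he, hf, h⟩ := hcol x y hxy
  rw [← hx] at he
  rw [← hy] at hf
  rcases incident_dartElem (by omega) (by omega) he with rfl | rfl <;>
    rcases incident_dartElem (by omega) (by omega) hf with rfl | rfl
  · exact ⟨_, _, Or.inl rfl, Or.inl rfl, h⟩
  · exact ⟨_, _, Or.inl rfl, Or.inr rfl, h⟩
  · exact ⟨_, _, Or.inr rfl, Or.inl rfl, h⟩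
  · exact ⟨_, _, Or.inr rfl, Or.inr rfl, h⟩

theorem not_down_and_down (hL : 3 ≤ L) (h3 : ¬ 3 ∣ L)
    (hcol : IncidentComparable (cycleWithTwoEars L) col) {d d' : Fin 6 × Bool} (hne : d.1 ≠ d'.1)
    (hs : dartStart d = dartStart d') (hd : ∀ j < 2 * L, Down col d j)
    (hd' : ∀ j < 2 * L, Down col d' j) : False := by
  obtain ⟨k, k', hk, hk', h | h⟩ := hcol.exists_dartElem hL hne one_pos (by omega)
  · exact not_reach_of_down hL h3 hne hs hd hd' (by omega) (by omega) (by omega) (by omega) h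
  · exact not_reach_of_down hL h3 hne.symm hs.symm hd' hd (by omega) (by omega) (by omega)
      (by omega) h

/-- Everything that is reachable from the edges at the vertex of position `L + 2` is in the
interior of the segment. -/
def IsStuck (col : EarVertex L ⊕ Sym2 (EarVertex L) → ZMod 3) (d : Fin 6 × Bool) : Prop :=
  ∀ i, (i = L + 1 ∨ i = L + 3) → ∀ f, Reach (cycleWithTwoEars L) col (dartElem L d i) f →
    ∃ k, 0 < k ∧ k < 2 * L ∧ f = dartElem L d k

/-- The positions from `j` to `L + 3` form a trap: the upper exit needs an arrow from `L + 3` to `L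
+ 4`, and the lower one needs two successive downward arrows through `j`. The bound `4 ≤ L` keeps `L
+ 3` inside the segment. -/
theorem isStuck_of_not_up (hL : 4 ≤ L) {d : Fin 6 × Bool} {j : ℕ} (h0 : 0 < j) (hj : j ≤ L)
    (hdown : ¬ (Down col d (j - 1) ∧ Down col d j)) (hup : ¬ Up col d (L + 3)) :
    IsStuck col d := by
  intro i hi f h
  -- Position `j` can only be entered from `j + 1`, so it carries the record `Down col d j`, which
  -- blocks the next arrow down.
  have key := Reach.mem_of_closed (S := fun y => (∃ k, j < k ∧ k ≤ L + 3 ∧ y = dartElem L d k) ∨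
    (y = dartElem L d j ∧ Down col d j)) ?_ (Or.inl ⟨i, by omega, by omega, rfl⟩) h
  · rcases key with ⟨k, hk, hk', rfl⟩ | ⟨rfl, _⟩
    · exact ⟨k, by omega, by omega, rfl⟩
    · exact ⟨j, h0, by omega, rfl⟩
  · rintro a b (⟨k, hk, hk', rfl⟩ | ⟨rfl, hjd⟩) hab
    · rcases incident_dartElem (by omega) (by omega) hab.1 with rfl | rfl
      · obtain ⟨k, rfl⟩ : ∃ l, k = l + 1 := ⟨k - 1, by omega⟩
        rcases (show j ≤ k by omega).eq_or_lt with rfl | hk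
        · exact Or.inr ⟨rfl, hab.2⟩
        · exact Or.inl ⟨k, hk, by omega, rfl⟩
      · rcases hk'.eq_or_lt with rfl | hk'
        · exact (hup hab.2).elim
        · exact Or.inl ⟨k + 1, by omega, by omega, rfl⟩
    · rcases incident_dartElem h0 (by omega) hab.1 with rfl | rfl
      · obtain ⟨j, rfl⟩ : ∃ l, j = l + 1 := ⟨j - 1, by omega⟩
        exact (hdown ⟨hab.2, hjd⟩).elim
      · exact Or.inl ⟨j + 1, by omega, by omega, rfl⟩

/-- The turning condition at `j` is invariant under negation, and the step after `L + 3` cannot go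
up for both signs. -/
theorem isStuck_or_isStuck_neg (hL : 4 ≤ L) {d : Fin 6 × Bool} {j : ℕ} (h0 : 0 < j) (hj : j ≤ L)
    (hup : ¬ (Up col d (j - 1) ∧ Up col d j)) (hdown : ¬ (Down col d (j - 1) ∧ Down col d j)) :
    IsStuck col d ∨ IsStuck (-col) d := by
  by_cases h : Up col d (L + 3)
  · right
    refine isStuck_of_not_up hL h0 hj ?_ ?_
    · rwa [down_neg, down_neg]
    · rw [up_neg]
      exact not_up_and_down h
  · exact Or.inl (isStuck_of_not_up hL h0 hj hdown h)

/-- A segment that cannot be traversed by arrows in one of the two directions. -/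
def IsBroken (col : EarVertex L ⊕ Sym2 (EarVertex L) → ZMod 3) (s : Fin 6) : Prop :=
  ¬ (∀ j < 2 * L, Up col (s, true) j) ∧ ¬ ∀ j < 2 * L, Down col (s, true) j

/-- Without a turning point the direction of the first step would propagate through the segment.
Reversing the segment, if necessary, puts the turning point into the first half. -/
theorem IsBroken.exists_isStuck (hL : 4 ≤ L) {s : Fin 6} (hs : IsBroken col s) :
    ∃ b, IsStuck col (s, b) ∨ IsStuck (-col) (s, b) := by
  have key : ∃ j, 0 < j ∧ j < 2 * L ∧
      ¬ (Up col (s, true) (j - 1) ∧ Up col (s, true) j) ∧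
      ¬ (Down col (s, true) (j - 1) ∧ Down col (s, true) j) := by
    by_contra! hc
    have hc' : ∀ j, j + 1 < 2 * L → (Up col (s, true) j ∧ Up col (s, true) (j + 1)) ∨
        (Down col (s, true) j ∧ Down col (s, true) (j + 1)) := by
      intro j hj
      by_contra hn
      rw [not_or] at hn
      exact hn.2 (hc (j + 1) (by omega) hj fun h => not_and.1 hn.1 h)
    rcases hc' 0 (by omega) with h | h
    · refine hs.1 fun j => ?_
      induction j with
      | zero => exact fun _ => h.1
      | succ j ih =>
        intro hj
        rcases hc' j hj with h' | h'
        · exact h'.2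
        · exact (not_up_and_down (ih (by omega)) h'.1).elim
    · refine hs.2 fun j => ?_
      induction j with
      | zero => exact fun _ => h.1
      | succ j ih =>
        intro hj
        rcases hc' j hj with h' | h'
        · exact (not_up_and_down h'.1 (ih (by omega))).elim
        · exact h'.2
  obtain ⟨j, h0, hj, hup, hdown⟩ := key
  rcases le_total j L with hjL | hjL
  · exact ⟨true, isStuck_or_isStuck_neg hL h0 hjL hup hdown⟩
  · refine ⟨false, isStuck_or_isStuck_neg hL (j := 2 * L - j) (by omega) (by omega) ?_ ?_⟩
    · rw [show (s, false) = dartRev (s, true) from rfl, up_dartRev (by omega),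
        up_dartRev (by omega), show 2 * L - 1 - (2 * L - j - 1) = j by omega,
        show 2 * L - 1 - (2 * L - j) = j - 1 by omega, and_comm]
      exact hdown
    · rw [show (s, false) = dartRev (s, true) from rfl, down_dartRev (by omega),
        down_dartRev (by omega), show 2 * L - 1 - (2 * L - j - 1) = j by omega,
        show 2 * L - 1 - (2 * L - j) = j - 1 by omega, and_comm]
      exact hup

/-- As `L` is even, position `L + 2` is a vertex. The two such vertices of different stuck segments
would have no comparable incident edges. -/
theorem IsStuck.fst_eq (hL : 4 ≤ L) (h2 : L % 2 = 0)
    (hcol : IncidentComparable (cycleWithTwoEars L) col) {d d' : Fin 6 × Bool}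
    (hd : IsStuck col d) (hd' : IsStuck col d') : d.1 = d'.1 := by
  by_contra hne
  obtain ⟨i, rfl⟩ : ∃ i, L = 2 * i := ⟨L / 2, by omega⟩
  obtain ⟨k, k', hk, hk', h⟩ := hcol.exists_dartElem (by omega) hne (i := i + 1)
    (by omega) (by omega)
  have : ∃ l l', 0 < l ∧ l < 2 * (2 * i) ∧ l' ≤ 2 * (2 * i) ∧
      dartElem (2 * i) d l = dartElem (2 * i) d' l' := by
    rcases h with h | h
    · obtain ⟨l, hl0, hl, e⟩ := hd k (by omega) _ h
      exact ⟨l, k', hl0, hl, by omega, e.symm⟩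
    · obtain ⟨l, hl0, hl, e⟩ := hd' k' (by omega) _ h
      exact ⟨k, l, by omega, by omega, hl.le, e⟩
  obtain ⟨l, l', hl0, hl, hl', e⟩ := this
  rcases dartElem_inj (by omega) hl0 hl hl' e with ⟨rfl, _⟩ | ⟨rfl, _⟩ <;> exact hne rfl

theorem not_incidentComparable_and_neg (hL : 4 ≤ L) (h2 : L % 2 = 0) (h3 : ¬ 3 ∣ L)
    (hcol : IncidentComparable (cycleWithTwoEars L) col)
    (hneg : IncidentComparable (cycleWithTwoEars L) (-col)) : False := by
  -- One segment may be stuck for each sign. The default `0` serves when there is none.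
  have two : ∃ s s', ∀ t, IsBroken col t → t = s ∨ t = s' := by
    have aux : ∃ s, ∀ b t, IsStuck col (t, b) → t = s := by
      by_cases h : ∃ d, IsStuck col d
      · obtain ⟨d, hd⟩ := h
        exact ⟨d.1, fun b t ht => ht.fst_eq hL h2 hcol hd⟩
      · exact ⟨0, fun b t ht => (h ⟨_, ht⟩).elim⟩
    have aux' : ∃ s, ∀ b t, IsStuck (-col) (t, b) → t = s := by
      by_cases h : ∃ d, IsStuck (-col) d
      · obtain ⟨d, hd⟩ := h
        exact ⟨d.1, fun b t ht => ht.fst_eq hL h2 hneg hd⟩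
      · exact ⟨0, fun b t ht => (h ⟨_, ht⟩).elim⟩
    obtain ⟨s, hs⟩ := aux
    obtain ⟨s', hs'⟩ := aux'
    refine ⟨s, s', fun t ht => ?_⟩
    obtain ⟨b, h | h⟩ := ht.exists_isStuck hL
    · exact Or.inl (hs b t h)
    · exact Or.inr (hs' b t h)
  have unbroken : ∀ d : Fin 6 × Bool, ¬ IsBroken col d.1 →
      (∀ j < 2 * L, Up col d j) ∨ ∀ j < 2 * L, Down col d j := by
    rintro ⟨s, b⟩ hd
    rw [IsBroken, not_and_or, not_not, not_not] at hd
    cases b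
    · rcases hd with h | h
      · exact Or.inr fun j hj => (down_dartRev (d := (s, true)) hj).2 (h _ (by omega))
      · exact Or.inl fun j hj => (up_dartRev (d := (s, true)) hj).2 (h _ (by omega))
    · exact hd
  have notDown : ∀ d d' : Fin 6 × Bool, d.1 ≠ d'.1 → dartStart d = dartStart d' →
      (∀ j < 2 * L, Down col d j) → (∀ j < 2 * L, Down col d' j) → False :=
    fun d d' => not_down_and_down (by omega) h3 hcol
  have notUp : ∀ d d' : Fin 6 × Bool, d.1 ≠ d'.1 → dartStart d = dartStart d' →
      (∀ j < 2 * L, Up col d j) → (∀ j < 2 * L, Up col d' j) → False :=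
    fun d d' hne hs hd hd' => not_down_and_down (by omega) h3 hneg hne hs
      (fun j hj => down_neg.2 (hd j hj)) fun j hj => down_neg.2 (hd' j hj)
  -- Of three monotone segments at a junction, two would agree in direction.
  have exists_broken : ∀ m, ∃ d, dartStart d = m ∧ IsBroken col d.1 := by
    intro m
    have three : ∀ m, ∃ a b c : Fin 6 × Bool, dartStart a = m ∧ dartStart b = m ∧
        dartStart c = m ∧ a.1 ≠ b.1 ∧ a.1 ≠ c.1 ∧ b.1 ≠ c.1 := by decide
    obtain ⟨a, b, c, rfl, hb, hc, hab, hac, hbc⟩ := three m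
    by_contra! hn
    rcases unbroken a (hn a rfl) with h1 | h1 <;> rcases unbroken b (hn b hb) with h2 | h2
    · exact notUp a b hab hb.symm h1 h2
    · rcases unbroken c (hn c hc) with h3 | h3
      · exact notUp a c hac hc.symm h1 h3
      · exact notDown b c hbc (hb.trans hc.symm) h2 h3
    · rcases unbroken c (hn c hc) with h3 | h3
      · exact notUp b c hbc (hb.trans hc.symm) h2 h3
      · exact notDown a c hac hc.symm h1 h3
    · exact notDown a b hab hb.symm h1 h2
  obtain ⟨s, s', hss⟩ := two
  -- Two segments that together touch all four junctions have disjoint ends, so each junction keeps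
  -- two of its three segments.
  have pair : ∀ s s' : Fin 6, (∀ m, ∃ d, dartStart d = m ∧ (d.1 = s ∨ d.1 = s')) →
      ∀ m, ∃ d d' : Fin 6 × Bool, dartStart d = m ∧ dartStart d' = m ∧ d.1 ≠ d'.1 ∧
        ¬ (d.1 = s ∨ d.1 = s') ∧ ¬ (d'.1 = s ∨ d'.1 = s') := by decide
  have next : ∀ m, ∃ m', JunctionStep col m m' := by
    intro m
    obtain ⟨d, d', rfl, hd', hne, h, h'⟩ := pair s s' (fun m => by
      obtain ⟨d, hd, hb⟩ := exists_broken m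
      exact ⟨d, hd, hss _ hb⟩) m
    rcases unbroken d (fun hb => h (hss _ hb)) with h1 | h1
    · exact ⟨_, d, rfl, rfl, h1⟩
    rcases unbroken d' (fun hb => h' (hss _ hb)) with h2 | h2
    · exact ⟨_, d', hd', rfl, h2⟩
    · exact (notDown d d' hne hd'.symm h1 h2).elim
  -- On a finite set, acyclicity gives a junction without an outgoing step, contrary to `next`.
  have wf : WellFounded (Function.swap (Relation.TransGen (JunctionStep col))) := by
    have : Std.Irrefl (Function.swap (Relation.TransGen (JunctionStep col))) :=
      ⟨fun a => not_transGen_junctionStep (by omega) h3 a⟩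
    have : IsTrans (Fin 4) (Function.swap (Relation.TransGen (JunctionStep col))) :=
      ⟨fun _ _ _ h h' => h'.trans h⟩
    exact Finite.wellFounded_of_trans_of_irrefl _
  obtain ⟨m, _, hm⟩ := wf.has_min Set.univ ⟨0, trivial⟩
  obtain ⟨m', h⟩ := next m
  exact hm m' trivial (Relation.TransGen.single h)

theorem not_isTotalProperConnected_of_le_three (hL : 4 ≤ L) (h2 : L % 2 = 0) (h3 : ¬ 3 ∣ L)
    {n : ℕ} (hn : n ≤ 3) (cv : EarVertex L → Fin n) (ce : Sym2 (EarVertex L) → Fin n) :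
    ¬ IsTotalProperConnected (cycleWithTwoEars L) cv ce := by
  intro h
  -- `ZMod 3` unfolds to `Fin 3`.
  have hf : Function.Injective (Fin.castLE hn : Fin n → ZMod 3) := Fin.castLE_injective hn
  have h' := h.comp_injective hf
  refine not_incidentComparable_and_neg hL h2 h3 h'.incidentComparable ?_
  convert (h'.comp_injective neg_injective).incidentComparable using 1
  funext x
  rcases x with x | x <;> rfl

end LowerBound

theorem tpc_cycleWithTwoEars {L : ℕ} (hL : 4 ≤ L) (h2 : L % 2 = 0) (h3 : ¬ 3 ∣ L) :
    tpc (cycleWithTwoEars L) = 4 := by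
  have h4 : 4 ∈ {n : ℕ | ∃ (cv : EarVertex L → Fin n) (ce : Sym2 (EarVertex L) → Fin n),
      IsTotalProperConnected (cycleWithTwoEars L) cv ce} :=
    ⟨_, _, isTotalProperConnected_earColor (by omega) h2⟩
  refine le_antisymm (Nat.sInf_le h4) (le_csInf ⟨4, h4⟩ ?_)
  rintro n ⟨cv, ce, h⟩
  by_contra hn
  exact not_isTotalProperConnected_of_le_three hL h2 h3 (by omega) cv ce h

end TotalProper

theorem proposition3 (k : ℕ) (hk : 2 ≤ k) :
    TotalProper.IsTwoConnected (TotalProper.cycleWithTwoEars (2 ^ k)) ∧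
    (TotalProper.cycleWithTwoEars (2 ^ k)).IsBipartite ∧
    TotalProper.tpc (TotalProper.cycleWithTwoEars (2 ^ k)) = 4 := by
  have h4 : 4 ≤ 2 ^ k := Nat.pow_le_pow_right (n := 2) two_pos hk
  have h2 : 2 ^ k % 2 = 0 := by
    rw [Nat.pow_mod, Nat.mod_self, Nat.zero_pow (by omega), Nat.zero_mod]
  have h3 : ¬ 3 ∣ 2 ^ k := fun h => by
    have := Nat.prime_three.dvd_of_dvd_pow h
    omega
  exact ⟨TotalProper.isTwoConnected_cycleWithTwoEars (by omega) h2,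
    TotalProper.cycleWithTwoEars_isBipartite h2, TotalProper.tpc_cycleWithTwoEars h4 h2 h3⟩
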